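/- Let $R$ be a commutative noetherian local ring with residue field $k$, let $n\ge 0$ be an integer, and let $M$ be a finitely generated $R$-module. An $n$-FPD hull of $M$ is a short exact sequence $0\to M\to Y\to X\to 0$ of finitely generated $R$-modules such that $\operatorname{pd}_R Y\le n$ and $\operatorname{Ext}^i_R(X,R)=0$ for all $1\le i\le n+1$. For $R$-modules $A,B$ let $\underline{\operatorname{Hom}}_R(A,B)$ be the quotient of $\operatorname{Hom}_R(A,B)$ by the submodule of homomorphisms that factor through a projective $R$-module. For a finitely generated $R$-module $A$, let $\Omega A$ be the kernel of a surjection from a finitely generated free module onto $A$; this induces an additive functor $\Omega$ on the stable category of finitely generated $R$-modules (whose morphism sets are the $\underline{\operatorname{Hom}}_R(A,B)$), with $n$-th iterate $\Omega^n$, where $\Omega^0$ is the identity. Put $$\xi_R(n,M)=\dim_k\operatorname{Ker}\bigl(\operatorname{Hom}_R(M,k)\to\underline{\operatorname{Hom}}_R(M,k)\xrightarrow{\ \Omega^n\ }\underline{\operatorname{Hom}}_R(\Omega^nM,\Omega^nk)\bigr),$$ and let $\mu_R(-)$ denote the minimal number of generators of a finitely generated $R$-module. Suppose that $M$ has an $n$-FPD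 hull. Then, for every $n$-FPD hull $0\to M\to Y\to X\to 0$ of $M$, $$\xi_R(n,M)=\mu_R(Y)-\mu_R(X).$$ -/

import Mathlib

universe u

noncomputable section

namespace StableModule

/-- The submodule `𝒫(M, N)` of `Hom_R(M, N)` of all homomorphisms that factor through some
projective module. -/
def projHom (R : Type u) [CommRing R] (M N : Type u) [AddCommGroup M] [Module R M]
    [AddCommGroup N] [Module R N] : Submodule R (M →ₗ[R] N) where
  carrier := {f | ∃ (P : Type u) (_ : AddCommGroup P) (_ : Module R P), Module.Projective R P ∧
    ∃ (g : M →ₗ[R] P) (h : P →ₗ[R] N), f = h ∘ₗ g}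
  add_mem' := by
    rintro _ _ ⟨P, _, _, _, g, h, rfl⟩ ⟨P', _, _, _, g', h', rfl⟩
    refine ⟨P × P', inferInstance, inferInstance, inferInstance, g.prod g', h.coprod h', ?_⟩
    ext x
    simp
  zero_mem' := ⟨PUnit.{u + 1}, inferInstance, inferInstance, inferInstance, 0, 0, by simp⟩
  smul_mem' := by
    rintro c _ ⟨P, _, _, _, g, h, rfl⟩
    exact ⟨P, inferInstance, inferInstance, inferInstance, g, c • h, by ext x; simp⟩

/-- The stable Hom module: `Hom_R(M, N)` modulo the maps factoring through a projective. -/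
abbrev StableHom (R : Type u) [CommRing R] (M N : Type u) [AddCommGroup M] [Module R M]
    [AddCommGroup N] [Module R N] : Type u :=
  (M →ₗ[R] N) ⧸ projHom R M N

section Lifts

variable {R : Type u} [CommRing R] {M N P Q : Type u}
  [AddCommGroup M] [Module R M] [AddCommGroup N] [Module R N]
  [AddCommGroup P] [Module R P] [AddCommGroup Q] [Module R Q]

/-- The map induced on kernels by a map `a` lying over `f`. -/
def kerMap (p : P →ₗ[R] M) (q : Q →ₗ[R] N) (f : M →ₗ[R] N) (a : P →ₗ[R] Q)
    (h : q ∘ₗ a = f ∘ₗ p) : LinearMap.ker p →ₗ[R] LinearMap.ker q :=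
  a.restrict fun x hx => by
    have := LinearMap.congr_fun h x
    simp only [LinearMap.comp_apply, LinearMap.mem_ker.1 hx, map_zero] at this
    exact LinearMap.mem_ker.2 this

/-- If `f` factors through a projective, so does every map it induces on the kernels of
`p` and `q`, when `P` is projective and `q` is surjective. -/
lemma kerMap_mem_projHom [Module.Projective R P] (p : P →ₗ[R] M) (q : Q →ₗ[R] N)
    (hq : Function.Surjective q) (f : M →ₗ[R] N) (hf : f ∈ projHom R M N) (a : P →ₗ[R] Q)
    (h : q ∘ₗ a = f ∘ₗ p) : kerMap p q f a h ∈ projHom R (LinearMap.ker p) (LinearMap.ker q) := by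
  obtain ⟨T, _, _, _, g, t, rfl⟩ := hf
  obtain ⟨t', ht'⟩ := Module.projective_lifting_property q t hq
  refine ⟨P, inferInstance, inferInstance, inferInstance, (LinearMap.ker p).subtype,
    (a - t' ∘ₗ g ∘ₗ p).codRestrict (LinearMap.ker q) ?_, ?_⟩
  · intro x
    have h1 := LinearMap.congr_fun h x
    have h2 := LinearMap.congr_fun ht' (g (p x))
    simp only [LinearMap.comp_apply] at h1 h2
    simp [h1, h2]
  · ext x
    have hx : p x = 0 := x.2
    simp [kerMap, hx]

/-- A chosen lift of `f : M → N` along `p : P → M` and `q : Q → N`. -/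
def projLift [Module.Projective R P] (p : P →ₗ[R] M) (q : Q →ₗ[R] N)
    (hq : Function.Surjective q) (f : M →ₗ[R] N) : P →ₗ[R] Q :=
  (Module.projective_lifting_property q (f ∘ₗ p) hq).choose

lemma comp_projLift [Module.Projective R P] (p : P →ₗ[R] M) (q : Q →ₗ[R] N)
    (hq : Function.Surjective q) (f : M →ₗ[R] N) : q ∘ₗ projLift p q hq f = f ∘ₗ p :=
  (Module.projective_lifting_property q (f ∘ₗ p) hq).choose_spec

/-- The stable class of the map `ker p → ker q` induced by a lift of `f` does not depend on
the lift. -/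
lemma mk_kerMap_eq [Module.Projective R P] (p : P →ₗ[R] M) (q : Q →ₗ[R] N)
    (hq : Function.Surjective q) (f : M →ₗ[R] N) (a b : P →ₗ[R] Q)
    (ha : q ∘ₗ a = f ∘ₗ p) (hb : q ∘ₗ b = f ∘ₗ p) :
    (Submodule.Quotient.mk (kerMap p q f a ha) :
        StableHom R (LinearMap.ker p) (LinearMap.ker q)) =
      Submodule.Quotient.mk (kerMap p q f b hb) := by
  rw [Submodule.Quotient.eq]
  exact kerMap_mem_projHom p q hq 0 (zero_mem _) (a - b)
    (by rw [LinearMap.comp_sub, ha, hb, sub_self, LinearMap.zero_comp])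

/-- The map sending `f : M → N` to the stable class of the induced map `ker p → ker q`. -/
def homKer [Module.Projective R P] (p : P →ₗ[R] M) (q : Q →ₗ[R] N)
    (hq : Function.Surjective q) :
    (M →ₗ[R] N) →ₗ[R] StableHom R (LinearMap.ker p) (LinearMap.ker q) where
  toFun f := Submodule.Quotient.mk (kerMap p q f (projLift p q hq f) (comp_projLift p q hq f))
  map_add' f g := by
    rw [← Submodule.Quotient.mk_add]
    exact mk_kerMap_eq p q hq (f + g) (projLift p q hq (f + g))
      (projLift p q hq f + projLift p q hq g) (comp_projLift p q hq _)
      (by rw [LinearMap.comp_add, comp_projLift, comp_projLift, LinearMap.add_comp])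
  map_smul' c f := by
    rw [RingHom.id_apply, ← Submodule.Quotient.mk_smul]
    exact mk_kerMap_eq p q hq (c • f) (projLift p q hq (c • f)) (c • projLift p q hq f)
      (comp_projLift p q hq _) (by rw [LinearMap.comp_smul, comp_projLift, LinearMap.smul_comp])

/-- The map on stable Hom modules induced by taking kernels of `p` and `q`. -/
def stableKer [Module.Projective R P] (p : P →ₗ[R] M) (q : Q →ₗ[R] N)
    (hq : Function.Surjective q) :
    StableHom R M N →ₗ[R] StableHom R (LinearMap.ker p) (LinearMap.ker q) :=
  (projHom R M N).liftQ (homKer p q hq) fun f hf => by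
    rw [LinearMap.mem_ker]
    exact (Submodule.Quotient.mk_eq_zero _).2 (kerMap_mem_projHom p q hq f hf _ _)

end Lifts

section Syzygy

variable {R : Type u} [CommRing R]

/-- The rank of a chosen finite free module mapping onto `M`. -/
def coverRank (M : FGModuleCat.{u} R) : ℕ :=
  (Module.Finite.exists_fin' R M).choose

/-- A chosen surjection from a finite free module onto the finitely generated module `M`. -/
def cover (M : FGModuleCat.{u} R) : (Fin (coverRank M) → R) →ₗ[R] M :=
  (Module.Finite.exists_fin' R M).choose_spec.choose

lemma cover_surjective (M : FGModuleCat.{u} R) : Function.Surjective (cover M) :=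
  (Module.Finite.exists_fin' R M).choose_spec.choose_spec

variable [IsNoetherianRing R]

/-- The syzygy `Ω M` of a finitely generated module over a noetherian ring. -/
abbrev syzygy (M : FGModuleCat.{u} R) : FGModuleCat.{u} R :=
  FGModuleCat.of R (LinearMap.ker (cover M))

/-- The syzygy functor `f ↦ Ω f` on stable Hom modules. -/
def stableSyzygy (M N : FGModuleCat.{u} R) :
    StableHom R M N →ₗ[R] StableHom R (syzygy M) (syzygy N) :=
  stableKer (cover M) (cover N) (cover_surjective N)

/-- The `n`-th syzygy `Ωⁿ M`, with `Ω⁰ M = M` and `Ωⁿ⁺¹ M = Ω (Ωⁿ M)`. -/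
def iterSyzygy (M : FGModuleCat.{u} R) : ℕ → FGModuleCat.{u} R
  | 0 => M
  | n + 1 => syzygy (iterSyzygy M n)

/-- The `n`-th syzygy functor on stable Hom modules. -/
def stableIterSyzygy (M N : FGModuleCat.{u} R) :
    (n : ℕ) → StableHom R M N →ₗ[R] StableHom R (iterSyzygy M n) (iterSyzygy N n)
  | 0 => LinearMap.id
  | n + 1 => stableSyzygy (iterSyzygy M n) (iterSyzygy N n) ∘ₗ stableIterSyzygy M N n

/-- `V_n(M, N)`: the kernel of `Hom(M, N) → StableHom(M, N) → StableHom(Ωⁿ M, Ωⁿ N)`. -/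
def vanishing (n : ℕ) (M N : FGModuleCat.{u} R) : Submodule R (M →ₗ[R] N) :=
  LinearMap.ker (stableIterSyzygy M N n ∘ₗ (projHom R M N).mkQ)

end Syzygy

section Local

variable (R : Type u) [CommRing R] [IsLocalRing R] [IsNoetherianRing R]
  (M : Type u) [AddCommGroup M] [Module R M] [Module.Finite R M]

/-- `V_n(M) = V_n(M, k)` as a subspace of the `k`-vector space `Hom_R(M, k)`, where `k` is the
residue field of `R`. -/
def residueVanishing (n : ℕ) :
    Submodule (IsLocalRing.ResidueField R) (M →ₗ[R] IsLocalRing.ResidueField R) where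
  carrier := vanishing n (FGModuleCat.of R M) (FGModuleCat.of R (IsLocalRing.ResidueField R))
  add_mem' := Submodule.add_mem _
  zero_mem' := Submodule.zero_mem _
  smul_mem' c f hf := by
    obtain ⟨r, rfl⟩ := IsLocalRing.residue_surjective c
    have h : IsLocalRing.residue R r • f = r • f := by
      ext x
      simp only [LinearMap.smul_apply, Algebra.smul_def]
      rfl
    rw [h]
    exact Submodule.smul_mem
      (vanishing n (FGModuleCat.of R M) (FGModuleCat.of R (IsLocalRing.ResidueField R))) r hf

/-- The `n`-th approximated `ξ`-invariant `ξ_R(n, M) = dim_k V_n(M)`. -/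
def approxXi (n : ℕ) : ℕ :=
  Module.finrank (IsLocalRing.ResidueField R) (residueVanishing R M n)

end Local

/-- The minimal number of generators `μ_R(M)` of a finitely generated module. -/
def minGenerators (R : Type u) [CommRing R] (M : Type u) [AddCommGroup M] [Module R M] : ℕ :=
  (⊤ : Submodule R M).spanFinrank

/-- `0 → M → Y → X → 0` is an `n`-FPD hull of `M`: a short exact sequence of finitely generated
modules with `pd Y ≤ n` and `Extⁱ(X, R) = 0` for `1 ≤ i ≤ n + 1`. -/
structure IsFPDHull {R : Type u} [CommRing R] (n : ℕ) {M Y X : Type u}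
    [AddCommGroup M] [Module R M] [Module.Finite R M]
    [AddCommGroup Y] [Module R Y] [Module.Finite R Y]
    [AddCommGroup X] [Module R X] [Module.Finite R X]
    (j : M →ₗ[R] Y) (q : Y →ₗ[R] X) : Prop where
  injective : Function.Injective j
  exact : Function.Exact j q
  surjective : Function.Surjective q
  projectiveDimension_le : CategoryTheory.HasProjectiveDimensionLE (ModuleCat.of R Y) n
  ext_eq_zero : ∀ i : ℕ, 1 ≤ i → i ≤ n + 1 →
    Subsingleton (CategoryTheory.Abelian.Ext (ModuleCat.of R X) (ModuleCat.of R R) i)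

end StableModule

end

/-! The maps `M → k` killed by `Ωⁿ` are exactly those that extend along `j` to `Y`
(`mem_vanishing_iff_of_isFPDHull`). If `f` extends, `Ωⁿ f` factors through `Ωⁿ Y`, which is
projective since `pd Y ≤ n`. Conversely, the obstruction to extending `f` is the pushforward along
`f` of the hull's class in `Ext¹(X, M)`. Since `Extⁱ(X, R) = 0` for `1 ≤ i ≤ n`, dimension shifting
embeds `Ext¹(X, k)` in `Extⁿ⁺¹(X, Ωⁿ k)` and turns `f` into `Ωⁿ f`; the latter factors through a
finite free module, so `Extⁿ⁺¹(X, R) = 0` kills the obstruction. Left exactness of `Hom(-, k)` then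
gives `0 → Hom(X, k) → Hom(Y, k) → V_n(M) → 0`, and `dim Hom(A, k) = μ(A)`. -/

namespace StableModule

open CategoryTheory CategoryTheory.Abelian IsLocalRing

/-! ### Free covers and their extension classes -/

section Covers

variable {R : Type u} [CommRing R]

/-- A homomorphism that factors through a projective module factors through a finite free one
as soon as its target is finitely generated. -/
lemma exists_factor_of_mem_projHom {M N : Type u} [AddCommGroup M] [Module R M]
    [AddCommGroup N] [Module R N] [Module.Finite R N] {f : M →ₗ[R] N} (hf : f ∈ projHom R M N) :
    ∃ (r : ℕ) (a : M →ₗ[R] (Fin r → R)) (b : (Fin r → R) →ₗ[R] N), f = b ∘ₗ a := by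
  obtain ⟨P, _, _, _, g, h, rfl⟩ := hf
  obtain ⟨r, b, hb⟩ := Module.Finite.exists_fin' R N
  obtain ⟨h', rfl⟩ := Module.projective_lifting_property b h hb
  exact ⟨r, h' ∘ₗ g, b, rfl⟩

lemma shortExact_cover (A : FGModuleCat.{u} R) : (cover A).shortComplexKer.ShortExact :=
  LinearMap.shortExact_shortComplexKer (cover_surjective A)

/-- A lift of `f` to the covers gives a morphism of short exact sequences, and extension classes are
natural. This is one step of the dimension shift. -/
lemma extClass_cover_naturality {M N : FGModuleCat.{u} R} (f : M →ₗ[R] N)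
    (a : (Fin (coverRank M) → R) →ₗ[R] (Fin (coverRank N) → R))
    (h : cover N ∘ₗ a = f ∘ₗ cover M) :
    (shortExact_cover M).extClass.comp
        (Ext.mk₀ (ModuleCat.ofHom (kerMap (cover M) (cover N) f a h))) (add_zero 1) =
      (Ext.mk₀ (ModuleCat.ofHom f)).comp (shortExact_cover N).extClass (zero_add 1) := by
  let φ : (cover M).shortComplexKer ⟶ (cover N).shortComplexKer :=
    { τ₁ := ModuleCat.ofHom (kerMap (cover M) (cover N) f a h)
      τ₂ := ModuleCat.ofHom a
      τ₃ := ModuleCat.ofHom f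
      comm₁₂ := rfl
      comm₂₃ := ModuleCat.hom_ext h }
  exact ShortComplex.ShortExact.extClass_naturality _ _ φ

/-- If `Extⁱ(X, R) = 0` then `Extⁱ(X, F) = 0` for every finite free module `F`. -/
lemma ext_fin_eq_zero {X : ModuleCat.{u} R} {i : ℕ}
    (hX : Subsingleton (Ext X (ModuleCat.of R R) i)) {r : ℕ}
    (x : Ext X (ModuleCat.of R (Fin r → R)) i) : x = 0 := by
  -- Splitting the identity into coordinate projections and inclusions makes `x` a sum of classes
  -- passing through `Ext X R i`.
  have h : 𝟙 (ModuleCat.of R (Fin r → R)) = ∑ s : Fin r,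
      ModuleCat.ofHom (LinearMap.proj (R := R) (φ := fun _ : Fin r => R) s) ≫
        ModuleCat.ofHom (LinearMap.single R (fun _ : Fin r => R) s) := by
    ext : 1
    rw [ModuleCat.hom_sum]
    exact (LinearMap.ext fun v => by simp [LinearMap.sum_apply, Finset.univ_sum_single])
  rw [← Ext.comp_mk₀_id x, h, Ext.mk₀_sum, Ext.comp_sum]
  refine Finset.sum_eq_zero fun s _ => ?_
  rw [← Ext.mk₀_comp_mk₀, ← Ext.comp_assoc_of_third_deg_zero,
    hX.elim (x.comp (Ext.mk₀ (ModuleCat.ofHom (LinearMap.proj s))) (add_zero i)) 0, Ext.zero_comp]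

end Covers

/-! ### Functoriality of syzygies, and maps that extend to `Y` -/

section Functoriality

variable {R : Type u} [CommRing R] [IsNoetherianRing R]

/-- The syzygy functor can be computed with any lift of `f` to the chosen covers. -/
lemma stableSyzygy_mk {M N : FGModuleCat.{u} R} (f : M →ₗ[R] N)
    (a : (Fin (coverRank M) → R) →ₗ[R] (Fin (coverRank N) → R))
    (h : cover N ∘ₗ a = f ∘ₗ cover M) :
    stableSyzygy M N (Submodule.Quotient.mk f) =
      Submodule.Quotient.mk (kerMap (cover M) (cover N) f a h) :=
  mk_kerMap_eq _ _ (cover_surjective N) f _ _ _ _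

/-- The syzygy functor is compatible with composition. -/
lemma stableSyzygy_comp {L M N : FGModuleCat.{u} R} (f : L →ₗ[R] M) (g : M →ₗ[R] N) :
    ∃ (f' : syzygy L →ₗ[R] syzygy M) (g' : syzygy M →ₗ[R] syzygy N),
      stableSyzygy L M (Submodule.Quotient.mk f) = Submodule.Quotient.mk f' ∧
      stableSyzygy M N (Submodule.Quotient.mk g) = Submodule.Quotient.mk g' ∧
      stableSyzygy L N (Submodule.Quotient.mk (g ∘ₗ f)) = Submodule.Quotient.mk (g' ∘ₗ f') := by
  have ha := comp_projLift (cover L) (cover M) (cover_surjective M) f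
  have hb := comp_projLift (cover M) (cover N) (cover_surjective N) g
  refine ⟨_, _, stableSyzygy_mk f _ ha, stableSyzygy_mk g _ hb, ?_⟩
  rw [stableSyzygy_mk (g ∘ₗ f) (projLift _ _ (cover_surjective N) g ∘ₗ
    projLift _ _ (cover_surjective M) f)
    (by rw [← LinearMap.comp_assoc, hb, LinearMap.comp_assoc, ha, LinearMap.comp_assoc])]
  rfl

/-- Functoriality is phrased through representatives, since no composition is defined on
`StableHom`. -/
lemma stableIterSyzygy_comp {L M N : FGModuleCat.{u} R} (f : L →ₗ[R] M) (g : M →ₗ[R] N) (n : ℕ) :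
    ∃ (f' : iterSyzygy L n →ₗ[R] iterSyzygy M n) (g' : iterSyzygy M n →ₗ[R] iterSyzygy N n),
      stableIterSyzygy L M n (Submodule.Quotient.mk f) = Submodule.Quotient.mk f' ∧
      stableIterSyzygy M N n (Submodule.Quotient.mk g) = Submodule.Quotient.mk g' ∧
      stableIterSyzygy L N n (Submodule.Quotient.mk (g ∘ₗ f)) =
        Submodule.Quotient.mk (g' ∘ₗ f') := by
  induction n with
  | zero => exact ⟨f, g, rfl, rfl, rfl⟩
  | succ n ih =>
    obtain ⟨f₁, g₁, hf, hg, hfg⟩ := ih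
    obtain ⟨f₂, g₂, hf', hg', hfg'⟩ := stableSyzygy_comp f₁ g₁
    refine ⟨f₂, g₂, ?_, ?_, ?_⟩
    · exact (congrArg (stableSyzygy _ _) hf).trans hf'
    · exact (congrArg (stableSyzygy _ _) hg).trans hg'
    · exact (congrArg (stableSyzygy _ _) hfg).trans hfg'

/-- The iterated syzygy of a module of finite projective dimension is projective. -/
lemma projective_iterSyzygy (A : FGModuleCat.{u} R) (n : ℕ)
    (hA : HasProjectiveDimensionLE (ModuleCat.of R A) n) :
    Module.Projective R (iterSyzygy A n) := by
  -- Each syzygy lowers the bound on projective dimension by one, so `m + i` stays equal to `n`.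
  suffices H : ∀ m i, m + i = n →
      HasProjectiveDimensionLE (ModuleCat.of R (iterSyzygy A i)) m by
    have := (projective_iff_hasProjectiveDimensionLE_zero _).2 (H 0 n (zero_add n))
    exact (IsProjective.iff_projective _).2 this
  intro m i
  induction i generalizing m with
  | zero => rintro rfl; exact hA
  | succ i ih =>
    intro h
    exact ((shortExact_cover (iterSyzygy A i)).hasProjectiveDimensionLT_X₃_iff m
      ((IsProjective.iff_projective _).1 inferInstance)).1 (ih (m + 1) (by omega))

/-- Maps that extend along `j` into a module of projective dimension at most `n` are killed by
the `n`-th syzygy functor. -/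
lemma comp_mem_vanishing {M Y N : FGModuleCat.{u} R} (n : ℕ)
    (hY : HasProjectiveDimensionLE (ModuleCat.of R Y) n) (j : M →ₗ[R] Y) (g : Y →ₗ[R] N) :
    g ∘ₗ j ∈ vanishing n M N := by
  obtain ⟨j', g', -, -, h⟩ := stableIterSyzygy_comp j g n
  refine LinearMap.mem_ker.2 (h.trans ((Submodule.Quotient.mk_eq_zero _).2 ?_))
  exact ⟨iterSyzygy Y n, inferInstance, inferInstance, projective_iterSyzygy Y n hY, j', g', rfl⟩

end Functoriality

/-! ### Dimension shifting and the extension criterion -/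

section DimensionShift

variable {R : Type u} [CommRing R] [IsNoetherianRing R]

/-- The iterated connecting homomorphism `Ext¹(X, A) → Extⁿ⁺¹(X, Ωⁿ A)`. -/
noncomputable def iterConnecting (X : ModuleCat.{u} R) (A : FGModuleCat.{u} R) :
    (n : ℕ) → Ext X (ModuleCat.of R A) 1 →+ Ext X (ModuleCat.of R (iterSyzygy A n)) (n + 1)
  | 0 => AddMonoidHom.id _
  | n + 1 => ((shortExact_cover (iterSyzygy A n)).extClass.postcomp X rfl).comp
      (iterConnecting X A n)

/-- The kernel of each connecting map is the image of `Ext` into a finite free cover, which vanishes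
in degrees `1` to `n`. -/
lemma iterConnecting_injective (X : ModuleCat.{u} R) (A : FGModuleCat.{u} R) (n : ℕ)
    (hX : ∀ i, 1 ≤ i → i ≤ n → Subsingleton (Ext X (ModuleCat.of R R) i)) :
    Function.Injective (iterConnecting X A n) := by
  induction n with
  | zero => exact Function.injective_id
  | succ n ih =>
    have hinj : Function.Injective
        ((shortExact_cover (iterSyzygy A n)).extClass.postcomp X (rfl : n + 1 + 1 = n + 2)) := by
      rw [injective_iff_map_eq_zero]
      intro x hx
      obtain ⟨y, rfl⟩ :=
        Ext.covariant_sequence_exact₃ X (shortExact_cover (iterSyzygy A n)) x rfl hx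
      rw [ext_fin_eq_zero (hX (n + 1) (by omega) le_rfl) y, Ext.zero_comp]
    exact hinj.comp (ih fun i h h' => hX i h (by omega))

/-- Compatibility of the iterated connecting homomorphisms with the syzygy functors. -/
lemma iterConnecting_naturality (X : ModuleCat.{u} R) {M N : FGModuleCat.{u} R} (f : M →ₗ[R] N)
    (n : ℕ) : ∃ f' : iterSyzygy M n →ₗ[R] iterSyzygy N n,
      stableIterSyzygy M N n (Submodule.Quotient.mk f) = Submodule.Quotient.mk f' ∧
      ∀ x : Ext X (ModuleCat.of R M) 1,
        iterConnecting X N n (x.comp (Ext.mk₀ (ModuleCat.ofHom f)) (add_zero 1)) =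
          (iterConnecting X M n x).comp (Ext.mk₀ (ModuleCat.ofHom f')) (add_zero (n + 1)) := by
  induction n with
  | zero => exact ⟨f, rfl, fun x => rfl⟩
  | succ n ih =>
    obtain ⟨f₁, hf, hx⟩ := ih
    have ha := comp_projLift (cover (iterSyzygy M n)) (cover (iterSyzygy N n))
      (cover_surjective _) f₁
    refine ⟨kerMap _ _ f₁ _ ha, ?_, fun x => ?_⟩
    · exact (congrArg (stableSyzygy _ _) hf).trans (stableSyzygy_mk f₁ _ ha)
    · change (iterConnecting X N n _).comp (shortExact_cover _).extClass (rfl : n + 1 + 1 = n + 2) =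
        ((iterConnecting X M n x).comp (shortExact_cover _).extClass (rfl : n + 1 + 1 = n + 2)).comp
          (Ext.mk₀ (ModuleCat.ofHom (kerMap _ _ f₁ _ ha))) (add_zero (n + 2))
      rw [hx, Ext.comp_assoc_of_second_deg_zero, ← extClass_cover_naturality f₁ _ ha,
        ← Ext.comp_assoc_of_third_deg_zero]

/-- A map killed by the `n`-th syzygy functor annihilates `Ext¹(X, -)` when `Extⁱ(X, R) = 0` for
`1 ≤ i ≤ n + 1`. -/
lemma ext_comp_eq_zero_of_mem_vanishing {X : ModuleCat.{u} R} {M N : FGModuleCat.{u} R} {n : ℕ}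
    (hX : ∀ i, 1 ≤ i → i ≤ n + 1 → Subsingleton (Ext X (ModuleCat.of R R) i))
    {f : M →ₗ[R] N} (hf : f ∈ vanishing n M N) (x : Ext X (ModuleCat.of R M) 1) :
    x.comp (Ext.mk₀ (ModuleCat.ofHom f)) (add_zero 1) = 0 := by
  obtain ⟨f', hf', hx⟩ := iterConnecting_naturality X f n
  apply iterConnecting_injective X N n fun i h h' => hX i h (by omega)
  have hmem : f' ∈ projHom R (iterSyzygy M n) (iterSyzygy N n) :=
    (Submodule.Quotient.mk_eq_zero _).1 (hf'.symm.trans (LinearMap.mem_ker.1 hf))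
  obtain ⟨r, a, b, rfl⟩ := exists_factor_of_mem_projHom hmem
  rw [hx, map_zero, ModuleCat.ofHom_comp, ← Ext.mk₀_comp_mk₀, ← Ext.comp_assoc_of_third_deg_zero,
    ext_fin_eq_zero (hX (n + 1) (by omega) le_rfl)
      ((iterConnecting X M n x).comp (Ext.mk₀ (ModuleCat.ofHom a)) _), Ext.zero_comp]

lemma mem_vanishing_iff_of_isFPDHull {n : ℕ} {M Y X : Type u}
    [AddCommGroup M] [Module R M] [Module.Finite R M]
    [AddCommGroup Y] [Module R Y] [Module.Finite R Y]
    [AddCommGroup X] [Module R X] [Module.Finite R X]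
    {j : M →ₗ[R] Y} {q : Y →ₗ[R] X} (h : IsFPDHull n j q) (N : FGModuleCat.{u} R)
    (f : M →ₗ[R] N) :
    f ∈ vanishing n (FGModuleCat.of R M) N ↔ ∃ g : Y →ₗ[R] N, g ∘ₗ j = f := by
  constructor
  · intro hf
    let S := ModuleCat.shortComplexOfCompEqZero j q h.exact.linearMap_comp_eq_zero
    have hS : S.ShortExact := ModuleCat.shortComplex_shortExact S h.exact h.injective h.surjective
    -- The connecting map sends `f` to its composite with the class of the hull; as this is zero,
    -- `f` comes from `Hom(Y, N)`.
    obtain ⟨y, hy⟩ := Ext.contravariant_sequence_exact₁ hS _ (Ext.mk₀ (ModuleCat.ofHom f))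
      (add_zero 1) (ext_comp_eq_zero_of_mem_vanishing (M := FGModuleCat.of R M)
        h.ext_eq_zero hf hS.extClass)
    obtain ⟨g, rfl⟩ := (Ext.mk₀_bijective _ _).2 y
    rw [Ext.mk₀_comp_mk₀] at hy
    exact ⟨g.hom, congrArg ModuleCat.Hom.hom ((Ext.mk₀_bijective _ _).1 hy)⟩
  · rintro ⟨g, rfl⟩
    exact comp_mem_vanishing (M := FGModuleCat.of R M) (Y := FGModuleCat.of R Y) n
      h.projectiveDimension_le j g

end DimensionShift

/-! ### Minimal generators via `Hom(-, k)` -/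

section Generators

variable (R : Type u) [CommRing R] [IsLocalRing R]

/-- Restriction along an `R`-linear map, as a linear map over the residue field. -/
noncomputable def residueDualMap {A B : Type u} [AddCommGroup A] [Module R A]
    [AddCommGroup B] [Module R B]
    (f : A →ₗ[R] B) :
    (B →ₗ[R] ResidueField R) →ₗ[ResidueField R] (A →ₗ[R] ResidueField R) where
  toFun g := g ∘ₗ f
  map_add' _ _ := rfl
  map_smul' _ _ := rfl

variable (A : Type u) [AddCommGroup A] [Module R A] [Module.Finite R A]

instance finite_residueDual : Module.Finite (ResidueField R) (A →ₗ[R] ResidueField R) :=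
  Module.Finite.equiv (LinearMap.liftBaseChangeEquiv (R := R) (M := A) (ResidueField R)).symm

/-- The minimal number of generators of `A` is the dimension of `Hom(A, k)`. -/
lemma finrank_residueDual :
    Module.finrank (ResidueField R) (A →ₗ[R] ResidueField R) = minGenerators R A := by
  -- `Hom_R(A, k)` is the `k`-dual of `k ⊗ A`, whose dimension is the minimal number of generators
  -- by Nakayama.
  rw [(LinearMap.liftBaseChangeEquiv (R := R) (M := A) (ResidueField R)).finrank_eq,
    minGenerators, ← TensorProduct.spanFinrank_top_eq_of_residueField _ Module.Finite.fg_top,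
    ← Module.finrank_eq_spanFinrank_of_free]
  refine (Subspace.dual_finrank_eq (K := ResidueField R)).trans ?_
  exact (TensorProduct.AlgebraTensorModule.congr (LinearEquiv.refl (ResidueField R) _)
    (Submodule.topEquiv (R := R) (M := A))).symm.finrank_eq

end Generators

end StableModule

theorem proposition4p15 (R : Type u) [CommRing R] [IsLocalRing R] [IsNoetherianRing R] (n : ℕ)
    (M Y X : Type u)
    [AddCommGroup M] [Module R M] [Module.Finite R M]
    [AddCommGroup Y] [Module R Y] [Module.Finite R Y]
    [AddCommGroup X] [Module R X] [Module.Finite R X]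
    (j : M →ₗ[R] Y) (q : Y →ₗ[R] X) (h : StableModule.IsFPDHull n j q) :
    (StableModule.approxXi R M n : ℤ) =
      (StableModule.minGenerators R Y : ℤ) - (StableModule.minGenerators R X : ℤ) := by
  have hrange : StableModule.residueVanishing R M n =
      LinearMap.range (StableModule.residueDualMap R j) := by
    ext f
    exact StableModule.mem_vanishing_iff_of_isFPDHull h
      (FGModuleCat.of R (IsLocalRing.ResidueField R)) f
  have hker : LinearMap.ker (StableModule.residueDualMap R j) =
      LinearMap.range (StableModule.residueDualMap R q) := by
    ext g
    constructor
    · intro hg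
      have hle : LinearMap.ker q ≤ LinearMap.ker g := by
        intro y hy
        obtain ⟨m, rfl⟩ := (h.exact y).1 hy
        exact LinearMap.congr_fun hg m
      obtain ⟨e, he⟩ : ∃ e : X →ₗ[R] IsLocalRing.ResidueField R, e ∘ₗ q = g :=
        ⟨(LinearMap.ker q).liftQ g hle ∘ₗ (q.quotKerEquivOfSurjective h.surjective).symm, by
          ext y
          have : (q.quotKerEquivOfSurjective h.surjective).symm (q y) = Submodule.Quotient.mk y :=
            (LinearEquiv.symm_apply_eq _).2 rfl
          simp [this]⟩
      exact ⟨e, he⟩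
    · rintro ⟨e, rfl⟩
      refine LinearMap.mem_ker.2 (LinearMap.ext fun m => ?_)
      exact (congrArg e (h.exact.apply_apply_eq_zero m)).trans (map_zero e)
  have hinj : Function.Injective (StableModule.residueDualMap R q) := fun a b hab =>
    (LinearMap.cancel_right h.surjective).1 hab
  -- Rank–nullity for restriction along `j`: the image is `V_n(M)` and the kernel is a copy of
  -- `Hom(X, k)`.
  have hsum := (StableModule.residueDualMap R j).finrank_range_add_finrank_ker
  rw [hker, LinearMap.finrank_range_of_inj hinj, StableModule.finrank_residueDual,
    StableModule.finrank_residueDual, ← hrange] at hsum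
  rw [StableModule.approxXi, ← hsum]
  push_cast
  ring
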